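/- Let $X$ be a real or complex Banach space, let $A$ be the infinitesimal generator of a $C^0$-semigroup $(e^{tA})_{t\ge 0}$ of bounded linear operators on $X$, and let $1<p\le\infty$. For $i=1,\dots,m$ let $f_i:\mathbb{R}_0^+\times X\to X$ be continuous such that (A1) for every bounded set $C\subset X$ there exists $L\in L^\infty_{\rm loc}(\mathbb{R}_0^+,\mathbb{R}_0^+)$ with $\|f_i(t,\xi)-f_i(t,\eta)\|\le L(t)\,\|\xi-\eta\|$ for all $\xi,\eta\in C$ and all $t\ge 0$; (A2) there exist $\alpha,\beta\in L^\infty_{\rm loc}(\mathbb{R}_0^+,\mathbb{R}_0^+)$ with $\|f_i(t,\xi)\|\le \alpha(t)\,\|\xi\|+\beta(t)$ for all $\xi\in X$ and all $t\ge 0$. Then for all $T\ge 0$, all $\xi_0\in X$ and all $u=(u_1,\dots,u_m)\in L^p([0,T],\mathbb{R}^m)$ the equation $$\dot x(t)=Ax(t)+\sum_{i=1}^m u_i(t)\,f_i(t,x(t)),\qquad x(0)=\xi_0,$$ has a unique mild solution, i.e. there is exactly one $x\in C([0,T],X)$ satisfying $$x(t)=e^{tA}\xi_0+\sum_{i=1}^m\int_0^t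 e^{(t-s)A}u_i(s)\,f_i(s,x(s))\,\mathrm{d}s\qquad\text{for all } t\in[0,T].$$ Moreover, for all $T\ge 0$ and $\xi_0\in X$, the solution operator $\Phi:L^p([0,T],\mathbb{R}^m)\to C([0,T],X)$, which assigns to each control $u$ the unique mild solution, is compact (it maps bounded sets to relatively compact sets) and locally Lipschitz continuous (every $u_0$ has a neighborhood on which $\Phi$ is Lipschitz), where $C([0,T],X)$ carries the supremum norm. -/

import Mathlib

open MeasureTheory Set Filter Topology
open scoped ENNReal

namespace SemilinearControl

/-- `(S t)_{t ≥ 0}` is a `C⁰`-semigroup of bounded operators on `X`: a strongly continuous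
one-parameter semigroup. Only the values at `t ≥ 0` matter. -/
structure IsC0Semigroup {𝕜 X : Type*} [RCLike 𝕜] [NormedAddCommGroup X] [NormedSpace 𝕜 X]
    (S : ℝ → X →L[𝕜] X) : Prop where
  map_zero : S 0 = ContinuousLinearMap.id 𝕜 X
  map_add : ∀ s t : ℝ, 0 ≤ s → 0 ≤ t → S (s + t) = (S s).comp (S t)
  strongly_continuous : ∀ x : X, ContinuousOn (fun t => S t x) (Ici 0)

/-- The (possibly unbounded) operator `A` is the infinitesimal generator of `(S t)_{t ≥ 0}`:
`x ∈ D(A)` and `A x = y` if and only if `(S t x - x) / t → y` as `t ↓ 0`. -/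
def IsGenerator {𝕜 X : Type*} [RCLike 𝕜] [NormedAddCommGroup X] [NormedSpace 𝕜 X]
    [NormedSpace ℝ X] (A : X →ₗ.[𝕜] X) (S : ℝ → X →L[𝕜] X) : Prop :=
  ∀ x y : X, (x, y) ∈ A.graph ↔ Tendsto (fun t : ℝ => t⁻¹ • (S t x - x)) (𝓝[>] 0) (𝓝 y)

/-- `g` restricted to `[0, ∞)` belongs to `L^∞_loc(ℝ₀⁺, ℝ₀⁺)`. -/
def IsLocBounded (g : ℝ → ℝ) : Prop :=
  (∀ t, 0 ≤ t → 0 ≤ g t) ∧ ∀ T : ℝ, MemLp g ∞ (volume.restrict (Icc 0 T))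

/-- `f : ℝ₀⁺ × X → X` is Lipschitz in the second variable on bounded sets, with
`L^∞_loc`-Lipschitz rate. -/
def LipschitzOnBoundedSets {X : Type*} [NormedAddCommGroup X] (f : ℝ → X → X) : Prop :=
  ∀ C : Set X, Bornology.IsBounded C → ∃ L : ℝ → ℝ, IsLocBounded L ∧
    ∀ t, 0 ≤ t → ∀ ξ ∈ C, ∀ η ∈ C, ‖f t ξ - f t η‖ ≤ L t * ‖ξ - η‖

/-- `f : ℝ₀⁺ × X → X` is linearly bounded. -/
def LinearlyBounded {X : Type*} [NormedAddCommGroup X] (f : ℝ → X → X) : Prop :=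
  ∃ α β : ℝ → ℝ, IsLocBounded α ∧ IsLocBounded β ∧
    ∀ t, 0 ≤ t → ∀ ξ : X, ‖f t ξ‖ ≤ α t * ‖ξ‖ + β t

/-- The space of controls `L^p([0,T], ℝ^m)`. -/
abbrev Control (m : ℕ) (p : ℝ≥0∞) (T : ℝ) : Type :=
  Lp (EuclideanSpace ℝ (Fin m)) p (volume.restrict (Icc (0 : ℝ) T))

/-- `x ∈ C([0,T], X)` is a mild solution of `x' = A x + ∑ i, u_i(t) f_i(t, x)`, `x(0) = ξ₀`, where
`A` generates `(S t)_{t ≥ 0}`: for all `t ∈ [0,T]`,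
`x(t) = S(t) ξ₀ + ∑ i, ∫_0^t S(t-s) u_i(s) f_i(s, x(s)) ds`, the integrands being
(Bochner) integrable. `IccExtend hT x` agrees with `x` on `[0,T]`. -/
def IsMildSolution {𝕜 X : Type*} [RCLike 𝕜] [NormedAddCommGroup X] [NormedSpace 𝕜 X]
    [NormedSpace ℝ X] {m : ℕ} {p : ℝ≥0∞} {T : ℝ} (hT : 0 ≤ T) (S : ℝ → X →L[𝕜] X)
    (f : Fin m → ℝ → X → X) (ξ₀ : X) (u : Control m p T) (x : C(Icc (0 : ℝ) T, X)) : Prop :=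
  ∀ t : Icc (0 : ℝ) T,
    (∀ i, IntervalIntegrable (fun s => S (t - s) (u s i • f i s (IccExtend hT x s)))
      volume 0 t) ∧
    x t = S t ξ₀ + ∑ i, ∫ s in (0 : ℝ)..t, S (t - s) (u s i • f i s (IccExtend hT x s))

/-- A (not necessarily linear) map between metric spaces is compact if it maps bounded sets to
relatively compact sets. -/
def IsCompactMap {P Z : Type*} [PseudoMetricSpace P] [PseudoMetricSpace Z] (H : P → Z) : Prop :=
  ∀ B : Set P, Bornology.IsBounded B → IsCompact (closure (H '' B))

end SemilinearControl

/-!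
The mild solutions for a control `u` are the fixed points of the Picard operator
`x ↦ S(·) ξ₀ + ∑ i, ∫_0^· S(· - s) u_i(s) f_i(s, x(s)) ds` on `C([0,T], X)`.

Everything rests on one consequence of Hölder's inequality and `1 < p`: for every `ε > 0` there is
`r > 0` with `∫_0^t ‖u(s)‖ e^{rs} ds ≤ ε ‖u‖_p e^{rt}` for all controls `u` and all `t ∈ [0,T]`
(`Control.exists_weight_integral_le`). Measured against the weight `e^{rt}`, with `r` uniform on a
bounded set of controls, linear growth therefore gives an a priori bound on the Picard iterates and
on all fixed points (`exists_norm_picard_le`, `exists_norm_iterate_picard_le`). On the ball where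
they live the nonlinearities are Lipschitz, so the Picard operator halves weighted distances, up to
an error `C ‖u - v‖_p` when the control changes as well (`exists_norm_picard_sub_picard_le`). Hence
the iterates of `0` converge to a fixed point, and two fixed points for controls `u` and `v` are at
distance at most a constant times `‖u - v‖_p`, which is both uniqueness and local Lipschitz
continuity.

Compactness is obtained without weak convergence of controls, although the semigroup need not be
compact. If `g` takes values in a compact set, then `∫_0^t S(t - s) w(s) g(s) ds` stays in a
multiple of the closed absolutely convex hull of a compact set, which is compact by Mazur's theorem
(`IsC0Semigroup.exists_isCompact_duhamel_mem`). By induction, each Picard iterate of `0` takes its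
values in a compact set that depends only on the norm bound for the controls. The iterates converge
to the solutions uniformly over bounded sets of controls, so the values of all these solutions also
lie in a compact set. For such `g` the integrals are equicontinuous, again by the weighted
inequality (`IsC0Semigroup.exists_duhamel_equicontinuous`), and the Arzelà–Ascoli theorem applies.
-/

open MeasureTheory Set Filter Topology
open scoped ENNReal Pointwise

namespace SemilinearControl

/-! ### Weighted integrals of controls -/

theorem integral_exp_neg_mul_sub_le {r t : ℝ} (hr : 0 < r) :
    ∫ s in (0 : ℝ)..t, Real.exp (-(r * (t - s))) ≤ 1 / r := by
  have hderiv : ∀ s : ℝ, HasDerivAt (fun s => Real.exp (-(r * (t - s))) / r)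
      (Real.exp (-(r * (t - s)))) s := by
    intro s
    have h1 : HasDerivAt (fun s : ℝ => -(r * (t - s))) r s := by
      simpa using (((hasDerivAt_id s).const_sub t).const_mul r).fun_neg
    have h2 := h1.exp.div_const r
    rwa [mul_div_assoc, div_self hr.ne', mul_one] at h2
  rw [intervalIntegral.integral_eq_sub_of_hasDerivAt (fun s _ => hderiv s)
    (Continuous.intervalIntegrable (by fun_prop) _ _)]
  have : 0 ≤ Real.exp (-(r * (t - 0))) / r := by positivity
  simp only [sub_self, mul_zero, neg_zero, Real.exp_zero] at *
  linarith

section Control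

variable {m : ℕ} {p : ℝ≥0∞} {T : ℝ}

theorem Control.abs_apply_le (u : Control m p T) (i : Fin m) (s : ℝ) :
    |u s i| ≤ ‖u s‖ :=
  PiLp.norm_apply_le (u s) i

variable [Fact (1 ≤ p)]

theorem Control.integrableOn_norm (u : Control m p T) :
    IntegrableOn (fun s => ‖u s‖) (Icc 0 T) :=
  ((Lp.memLp u).integrable Fact.out).norm

theorem Control.intervalIntegrable_norm (u : Control m p T) {t : ℝ} (ht : t ∈ Icc 0 T) :
    IntervalIntegrable (fun s => ‖u s‖) volume 0 t := by
  rw [intervalIntegrable_iff_integrableOn_Icc_of_le ht.1]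
  exact u.integrableOn_norm.mono_set (Icc_subset_Icc_right ht.2)

theorem Control.integrableOn_apply (u : Control m p T) (i : Fin m) :
    IntegrableOn (fun s => u s i) (Icc 0 T) :=
  (EuclideanSpace.proj (𝕜 := ℝ) i).integrable_comp ((Lp.memLp u).integrable Fact.out)

/-- The exponential weight makes the `L¹` norm of a control small: by Hölder's inequality the
left-hand side is at most `‖u‖_p e^{rt}` times the `L^q` norm of `s ↦ e^{-r(t-s)}` on `[0,t]`, where
`q` is the exponent conjugate to `p`, and this norm tends to `0` as `r → ∞` because `1 < p` forces
`q < ∞`. -/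
theorem Control.exists_weight_integral_le (hp : 1 < p) (T : ℝ) {ε : ℝ} (hε : 0 < ε) :
    ∃ r : ℝ, 0 < r ∧ ∀ u : Control m p T, ∀ t ∈ Icc 0 T,
      ∫ s in (0 : ℝ)..t, ‖u s‖ * Real.exp (r * s) ≤ ε * ‖u‖ * Real.exp (r * t) := by
  have hconj : p.HolderConjugate p.conjExponent := ENNReal.HolderConjugate.conjExponent hp.le
  set q := p.conjExponent
  have hq1 : 1 ≤ q := ENNReal.HolderConjugate.one_le q p
  have hqtop : q ≠ ∞ := (ENNReal.HolderConjugate.lt_top_iff_one_lt q p).2 hp |>.ne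
  have hq1' : 1 ≤ q.toReal := by
    have := ENNReal.toReal_mono hqtop hq1
    simpa using this
  -- The rate `r = ε⁻ᵠ` makes `(1 / r) ^ (1 / q)` equal to `ε`.
  refine ⟨(ε ^ q.toReal)⁻¹, by positivity, fun u t ht => ?_⟩
  set r := (ε ^ q.toReal)⁻¹ with hrdef
  have hr : 0 < r := by positivity
  set ν := volume.restrict (Ioc 0 t)
  have hν : ν ≤ volume.restrict (Icc 0 T) :=
    Measure.restrict_mono (Ioc_subset_Icc_self.trans (Icc_subset_Icc_right ht.2)) le_rfl
  set e : ℝ → ℝ := fun s => Real.exp (-(r * (t - s))) with he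
  have hec : Continuous e := by fun_prop
  have hum : AEStronglyMeasurable u ν := (Lp.aestronglyMeasurable u).mono_measure hν
  have h1 : eLpNorm e q ν ≤ ENNReal.ofReal ε := by
    rw [eLpNorm_eq_lintegral_rpow_enorm_toReal (by positivity) hqtop]
    have h2 : ∫⁻ s, ‖e s‖ₑ ^ q.toReal ∂ν ≤ ENNReal.ofReal (ε ^ q.toReal) := by
      calc ∫⁻ s, ‖e s‖ₑ ^ q.toReal ∂ν ≤ ∫⁻ s, ENNReal.ofReal (e s) ∂ν := by
            refine setLIntegral_mono' measurableSet_Ioc fun s hs => ?_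
            -- As `0 ≤ e s ≤ 1` and `1 ≤ q`, the `q`-th power of `e s` is at most `e s` itself.
            have hle : e s ≤ 1 := Real.exp_le_one_iff.2 (by nlinarith [hs.2])
            rw [Real.enorm_of_nonneg (Real.exp_pos _).le,
              ENNReal.ofReal_rpow_of_nonneg (Real.exp_pos _).le (by positivity)]
            exact ENNReal.ofReal_le_ofReal
              (Real.rpow_le_self_of_le_one (Real.exp_pos _).le hle hq1')
        _ = ENNReal.ofReal (∫ s, e s ∂ν) := by
            rw [ofReal_integral_eq_lintegral_ofReal]
            · exact (hec.integrableOn_Icc (a := 0) (b := t)).mono_set Ioc_subset_Icc_self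
            · exact .of_forall fun s => (Real.exp_pos _).le
        _ ≤ ENNReal.ofReal (ε ^ q.toReal) := by
            refine ENNReal.ofReal_le_ofReal ?_
            have := integral_exp_neg_mul_sub_le (t := t) hr
            rw [intervalIntegral.integral_of_le ht.1] at this
            simpa [hrdef] using this
    calc _ ≤ ENNReal.ofReal (ε ^ q.toReal) ^ (1 / q.toReal) := by gcongr
      _ = ENNReal.ofReal ε := by
        rw [ENNReal.ofReal_rpow_of_nonneg (by positivity) (by positivity), one_div,
          Real.rpow_rpow_inv hε.le (by positivity)]
  have h3 : eLpNorm (e • (u : ℝ → EuclideanSpace ℝ (Fin m))) 1 ν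
      ≤ ENNReal.ofReal (ε * ‖u‖) := by
    have : q.HolderConjugate p := hconj.symm
    refine (eLpNorm_smul_le_mul_eLpNorm (p := q) (q := p) hum hec.aestronglyMeasurable).trans ?_
    rw [ENNReal.ofReal_mul hε.le]
    gcongr
    refine (eLpNorm_mono_measure _ hν).trans ?_
    rw [Lp.norm_def, ENNReal.ofReal_toReal (Lp.eLpNorm_ne_top u)]
  have h4 : ∫ s in (0 : ℝ)..t, ‖u s‖ * e s ≤ ε * ‖u‖ := by
    rw [intervalIntegral.integral_of_le ht.1, integral_eq_lintegral_of_nonneg_ae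
      (.of_forall fun s => mul_nonneg (norm_nonneg _) (Real.exp_pos _).le)
      (hum.norm.mul (f := fun s => ‖u s‖) hec.aestronglyMeasurable :
        AEStronglyMeasurable (fun s => ‖u s‖ * e s) ν)]
    refine ENNReal.toReal_le_of_le_ofReal (by positivity) ?_
    rw [eLpNorm_one_eq_lintegral_enorm] at h3
    refine (lintegral_congr fun s => ?_).trans_le h3
    rw [← Real.enorm_of_nonneg (mul_nonneg (norm_nonneg _) (Real.exp_pos _).le)]
    rw [Pi.smul_apply', enorm_smul, enorm_mul, enorm_norm, mul_comm]
  calc ∫ s in (0 : ℝ)..t, ‖u s‖ * Real.exp (r * s)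
      = (∫ s in (0 : ℝ)..t, ‖u s‖ * e s) * Real.exp (r * t) := by
        rw [← intervalIntegral.integral_mul_const]
        refine intervalIntegral.integral_congr fun s _ => ?_
        simp only [he]
        rw [mul_assoc, ← Real.exp_add]
        ring_nf
    _ ≤ _ := by gcongr

theorem Control.exists_mul_weight_integral_le_half (hp : 1 < p) (T R : ℝ) {κ : ℝ} (hκ : 0 ≤ κ) :
    ∃ r : ℝ, 0 < r ∧ ∀ u : Control m p T, ‖u‖ ≤ R → ∀ t ∈ Icc 0 T,
      κ * ∫ s in (0 : ℝ)..t, ‖u s‖ * Real.exp (r * s) ≤ 1 / 2 * Real.exp (r * t) := by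
  have hR : 0 < max R 0 + 1 := by positivity
  obtain ⟨r, hr, h⟩ := Control.exists_weight_integral_le (m := m) hp T
    (ε := 1 / (2 * (κ + 1) * (max R 0 + 1))) (by positivity)
  refine ⟨r, hr, fun u hu t ht => ?_⟩
  have hu' : ‖u‖ ≤ max R 0 + 1 := hu.trans ((le_max_left _ _).trans (by linarith))
  calc κ * ∫ s in (0 : ℝ)..t, ‖u s‖ * Real.exp (r * s)
      ≤ (κ + 1) * (1 / (2 * (κ + 1) * (max R 0 + 1)) * (max R 0 + 1) * Real.exp (r * t)) := by
        refine mul_le_mul (by linarith) ((h u t ht).trans (by gcongr)) ?_ (by positivity)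
        exact intervalIntegral.integral_nonneg ht.1 fun s _ => by positivity
    _ = 1 / 2 * Real.exp (r * t) := by field_simp

theorem Control.exists_integral_le (hp : 1 < p) (T : ℝ) :
    ∃ c : ℝ, 0 ≤ c ∧ ∀ u : Control m p T, ∀ t ∈ Icc 0 T,
      ∫ s in (0 : ℝ)..t, ‖u s‖ ≤ c * ‖u‖ := by
  obtain ⟨r, hr, h⟩ := Control.exists_weight_integral_le (m := m) hp T one_pos
  refine ⟨Real.exp (r * T), by positivity, fun u t ht => ?_⟩
  have hi := u.intervalIntegrable_norm ht
  calc ∫ s in (0 : ℝ)..t, ‖u s‖ ≤ ∫ s in (0 : ℝ)..t, ‖u s‖ * Real.exp (r * s) := by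
        refine intervalIntegral.integral_mono_on ht.1 hi
          (hi.mul_continuousOn (by fun_prop)) fun s hs => ?_
        exact le_mul_of_one_le_right (norm_nonneg _)
          (Real.one_le_exp (mul_nonneg hr.le hs.1))
    _ ≤ 1 * ‖u‖ * Real.exp (r * t) := h u t ht
    _ ≤ Real.exp (r * T) * ‖u‖ := by
        rw [one_mul, mul_comm]
        have := ht.2
        gcongr

/-- Bounded sets of controls are uniformly integrable on short time intervals. -/
theorem Control.exists_integral_small (hp : 1 < p) (T R : ℝ)
    {ε : ℝ} (hε : 0 < ε) : ∃ δ > 0, ∀ u : Control m p T, ‖u‖ ≤ R → ∀ t ∈ Icc 0 T, ∀ t' ∈ Icc t T,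
      t' - t < δ → ∫ s in t..t', ‖u s‖ ≤ ε := by
  set R' := max R 0
  obtain ⟨r, hr, h⟩ := Control.exists_weight_integral_le (m := m) hp T
    (ε := ε / (Real.exp 1 * (R' + 1))) (by positivity)
  -- Over a time step shorter than `1 / r` the weight changes by a factor of at most `exp 1`.
  refine ⟨1 / r, by positivity, fun u hu t ht t' ht' hd => ?_⟩
  have ht'T : t' ∈ Icc 0 T := ⟨ht.1.trans ht'.1, ht'.2⟩
  have hi := u.intervalIntegrable_norm ht'T
  have hie : IntervalIntegrable (fun s => ‖u s‖ * Real.exp (r * s)) volume 0 t' :=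
    hi.mul_continuousOn (by fun_prop)
  have hs1 : uIcc t t' ⊆ uIcc 0 t' := by
    rw [uIcc_of_le ht'.1, uIcc_of_le ht'T.1]; exact Icc_subset_Icc_left ht.1
  have hs2 : uIcc 0 t ⊆ uIcc 0 t' := by
    rw [uIcc_of_le ht.1, uIcc_of_le ht'T.1]; exact Icc_subset_Icc_right ht'.1
  have h1 : (∫ s in t..t', ‖u s‖) * Real.exp (r * t) ≤
      ∫ s in t..t', ‖u s‖ * Real.exp (r * s) := by
    rw [← intervalIntegral.integral_mul_const]
    refine intervalIntegral.integral_mono_on ht'.1 ((hi.mono_set hs1).mul_const _)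
      (hie.mono_set hs1) fun s hs => ?_
    have := hs.1
    gcongr
  have h2 : ∫ s in t..t', ‖u s‖ * Real.exp (r * s) ≤
      ∫ s in (0 : ℝ)..t', ‖u s‖ * Real.exp (r * s) := by
    rw [← intervalIntegral.integral_add_adjacent_intervals (hie.mono_set hs2) (hie.mono_set hs1)]
    have : 0 ≤ ∫ s in (0 : ℝ)..t, ‖u s‖ * Real.exp (r * s) :=
      intervalIntegral.integral_nonneg ht.1 fun s _ => by positivity
    linarith
  have h3 : Real.exp (r * t') ≤ Real.exp 1 * Real.exp (r * t) := by
    rw [← Real.exp_add]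
    refine Real.exp_le_exp.2 ?_
    rw [lt_div_iff₀ hr] at hd
    nlinarith
  have hR : ‖u‖ ≤ R' + 1 := hu.trans ((le_max_left _ _).trans (by linarith))
  have hR' : 0 < R' + 1 := by positivity
  refine le_of_mul_le_mul_right ?_ (Real.exp_pos (r * t))
  calc _ ≤ ε / (Real.exp 1 * (R' + 1)) * ‖u‖ * Real.exp (r * t') :=
        h1.trans (h2.trans (h u t' ht'T))
    _ ≤ ε / (Real.exp 1 * (R' + 1)) * (R' + 1) * (Real.exp 1 * Real.exp (r * t)) := by gcongr
    _ = ε * Real.exp (r * t) := by field_simp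

end Control

/-! ### Essential bounds, weighted suprema and compactness criteria -/

theorem IsLocBounded.exists_ae_le {g : ℝ → ℝ} (hg : IsLocBounded g) (T : ℝ) :
    ∃ c : ℝ, 0 ≤ c ∧ ∀ᵐ t, t ∈ Icc 0 T → g t ≤ c := by
  have h := (hg.2 T).2
  rw [eLpNorm_exponent_top] at h
  refine ⟨(eLpNormEssSup g (volume.restrict (Icc 0 T))).toReal, by positivity, ?_⟩
  have h2 := ae_le_eLpNormEssSup (f := g) (μ := volume.restrict (Icc 0 T))
  rw [ae_restrict_iff' measurableSet_Icc] at h2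
  filter_upwards [h2] with t ht hmem
  refine (Real.le_norm_self _).trans ?_
  rw [← toReal_enorm]
  exact ENNReal.toReal_mono h.ne (ht hmem)

/-- A Gronwall argument: if every weighted bound `a` for `z` improves to `a / 2 + b`, then the best
weighted bound is at most `2 * b`. -/
theorem norm_le_of_forall_weighted_le {X : Type*} [NormedAddCommGroup X] {T r b : ℝ} (hT : 0 ≤ T)
    (z : C(Icc (0 : ℝ) T, X))
    (h : ∀ a, 0 ≤ a → (∀ t, ‖z t‖ ≤ a * Real.exp (r * t)) →
      ∀ t, ‖z t‖ ≤ (a / 2 + b) * Real.exp (r * t)) (t : Icc (0 : ℝ) T) :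
    ‖z t‖ ≤ 2 * b * Real.exp (r * t) := by
  have : Nonempty (Icc (0 : ℝ) T) := ⟨⟨0, left_mem_Icc.2 hT⟩⟩
  obtain ⟨t₀, -, ht₀⟩ := isCompact_univ.exists_isMaxOn univ_nonempty
    (f := fun t : Icc (0 : ℝ) T => ‖z t‖ * Real.exp (-(r * t))) (by fun_prop)
  set a := ‖z t₀‖ * Real.exp (-(r * t₀)) with ha
  have hz : ∀ t : Icc (0 : ℝ) T, ‖z t‖ ≤ a * Real.exp (r * t) := fun t => by
    have h1 : ‖z t‖ * Real.exp (-(r * t)) ≤ a := ht₀ (mem_univ t)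
    rwa [Real.exp_neg, ← div_eq_mul_inv, div_le_iff₀ (Real.exp_pos _)] at h1
  have h2 := h a (by positivity) hz t₀
  rw [← div_le_iff₀ (Real.exp_pos _), div_eq_mul_inv, ← Real.exp_neg, ← ha] at h2
  exact (hz t).trans (by gcongr; linarith)

theorem isCompact_closure_of_forall_exists_isCompact {X : Type*} [PseudoMetricSpace X]
    [CompleteSpace X] {W : Set X}
    (h : ∀ ε > 0, ∃ K, IsCompact K ∧ ∀ w ∈ W, ∃ k ∈ K, dist w k < ε) : IsCompact (closure W) := by
  refine TotallyBounded.isCompact_of_isClosed (TotallyBounded.closure ?_) isClosed_closure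
  refine Metric.totallyBounded_iff.2 fun ε hε => ?_
  obtain ⟨K, hK, hW⟩ := h (ε / 2) (half_pos hε)
  obtain ⟨F, -, hF, hKF⟩ := hK.finite_cover_balls (half_pos hε)
  refine ⟨F, hF, fun w hw => ?_⟩
  obtain ⟨k, hk, hwk⟩ := hW w hw
  obtain ⟨y, hy, hky⟩ := mem_iUnion₂.1 (hKF hk)
  exact mem_iUnion₂.2 ⟨y, hy, by
    rw [Metric.mem_ball] at hky ⊢; linarith [dist_triangle w k y]⟩

/-- The Arzelà–Ascoli theorem for `C(Y, X)` with `Y` compact metric and a common modulus of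
continuity. -/
theorem isCompact_closure_of_uniformEquicontinuous {Y X : Type*} [PseudoMetricSpace Y]
    [CompactSpace Y] [MetricSpace X] {A : Set C(Y, X)} {K : Set X} (hK : IsCompact K)
    (hAK : ∀ x ∈ A, ∀ t, x t ∈ K)
    (heq : ∀ ε > 0, ∃ δ > 0, ∀ x ∈ A, ∀ t t', dist t t' < δ → dist (x t) (x t') < ε) :
    IsCompact (closure A) := by
  set e := (ContinuousMap.isometryEquivBoundedOfCompact Y X).toHomeomorph
  rw [← e.isCompact_image, e.image_closure]
  refine BoundedContinuousFunction.arzela_ascoli K hK _ ?_ ?_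
  · rintro _ t ⟨x, hx, rfl⟩
    exact hAK x hx t
  · refine (Metric.uniformEquicontinuous_iff.2 fun ε hε => ?_).equicontinuous
    obtain ⟨δ, hδ, h⟩ := heq ε hε
    refine ⟨δ, hδ, ?_⟩
    rintro t t' hd ⟨_, x, hx, rfl⟩
    exact h x hx t t' hd

/-- An integral of a `K`-valued function against a scalar density of mass at most `c` lies in `c`
times the closed absolutely convex hull of `K`. Otherwise a continuous linear functional would
separate the two. -/
theorem intervalIntegral_mem_smul_closedAbsConvexHull {E : Type*} [NormedAddCommGroup E]
    [NormedSpace ℝ E] [CompleteSpace E] {K : Set E} (hK : IsCompact K) {w ω : ℝ → ℝ} {h : ℝ → E}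
    {t c : ℝ} (ht : 0 ≤ t) (hc : 0 < c) (hω : IntervalIntegrable ω volume 0 t)
    (hwω : ∀ s, |w s| ≤ ω s) (hωc : ∫ s in (0 : ℝ)..t, ω s ≤ c)
    (hK0 : K.Nonempty) (hh : ∀ s ∈ Ioc 0 t, h s ∈ K)
    (hint : IntervalIntegrable (fun s => w s • h s) volume 0 t) :
    ∫ s in (0 : ℝ)..t, w s • h s ∈ c • closedAbsConvexHull ℝ K := by
  set D := closedAbsConvexHull ℝ K
  have hKD : K ⊆ D := subset_closedAbsConvexHull
  have hDc : IsCompact (c • D) :=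
    (isCompact_closedAbsConvexHull_of_totallyBounded hK.totallyBounded).smul c
  have hDcv : AbsConvex ℝ D := absConvex_convexClosedHull
  by_contra hmem
  obtain ⟨φ, b, hφb, hbφ⟩ :=
    geometric_hahn_banach_closed_point (hDcv.2.smul c) hDc.isClosed hmem
  have hφ : ∀ k ∈ K, |φ k| ≤ b / c := by
    intro k hk
    rw [le_div_iff₀ hc, ← abs_of_pos hc, ← abs_mul, abs_le']
    have h1 := hφb _ (smul_mem_smul_set (hKD hk))
    have h2 := hφb _ (smul_mem_smul_set ((hDcv.1.neg_mem_iff).2 (hKD hk)))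
    simp only [smul_neg, map_neg, map_smul, smul_eq_mul] at h1 h2
    constructor <;> linarith
  obtain ⟨k, hk⟩ := hK0
  have hb : 0 ≤ b / c := (abs_nonneg _).trans (hφ k hk)
  rw [← φ.intervalIntegral_comp_comm hint] at hbφ
  have : ‖∫ s in (0 : ℝ)..t, φ (w s • h s)‖ ≤ ∫ s in (0 : ℝ)..t, ω s * (b / c) := by
    refine intervalIntegral.norm_integral_le_of_norm_le ht (.of_forall fun s hs => ?_)
      (hω.mul_const _)
    rw [map_smul, norm_smul, Real.norm_eq_abs, Real.norm_eq_abs]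
    have := hφ _ (hh s hs)
    have := hwω s
    gcongr
    exact (abs_nonneg _).trans (hwω s)
  rw [intervalIntegral.integral_mul_const, Real.norm_eq_abs] at this
  have h3 : (∫ s in (0 : ℝ)..t, ω s) * (b / c) ≤ c * (b / c) := by gcongr
  rw [mul_div_cancel₀ _ hc.ne'] at h3
  linarith [le_abs_self (∫ s in (0 : ℝ)..t, φ (w s • h s))]

/-! ### Strongly continuous semigroups on bounded time intervals -/

section Semigroup

variable {𝕜 X : Type*} [RCLike 𝕜] [NormedAddCommGroup X] [NormedSpace 𝕜 X] [CompleteSpace X]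
  {S : ℝ → X →L[𝕜] X}

/-- By the uniform boundedness principle, the semigroup is bounded on `[0,T]`. -/
theorem IsC0Semigroup.exists_norm_le (hS : IsC0Semigroup S) (T : ℝ) :
    ∃ M : ℝ, 0 < M ∧ ∀ t ∈ Icc 0 T, ‖S t‖ ≤ M := by
  obtain ⟨C, hC⟩ := banach_steinhaus (g := fun t : Icc 0 T => S t) fun x => by
    obtain ⟨C, hC⟩ := isCompact_Icc.exists_bound_of_continuousOn
      ((hS.strongly_continuous x).mono (Icc_subset_Ici_self : Icc 0 T ⊆ _))
    exact ⟨C, fun t => hC t t.2⟩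
  exact ⟨max C 1, by positivity, fun t ht => (hC ⟨t, ht⟩).trans (le_max_left _ _)⟩

theorem IsC0Semigroup.continuousOn_uncurry (hS : IsC0Semigroup S) (T : ℝ) :
    ContinuousOn (fun q : ℝ × X => S q.1 q.2) (Icc 0 T ×ˢ univ) := by
  obtain ⟨M, hM, hSM⟩ := hS.exists_norm_le T
  refine continuousOn_prod_of_continuousOn_lipschitzOnWith' _ M.toNNReal ?_ ?_
  · intro t ht
    refine LipschitzWith.lipschitzOnWith (LipschitzWith.of_dist_le_mul fun x y => ?_)
    rw [dist_eq_norm, dist_eq_norm, ← map_sub, Real.coe_toNNReal _ hM.le]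
    exact (S t).le_of_opNorm_le (hSM t ht) _
  · exact fun x _ => (hS.strongly_continuous x).mono Icc_subset_Ici_self

/-- On a compact set of initial values, the orbits of the semigroup are uniformly equicontinuous. -/
theorem IsC0Semigroup.exists_equicontinuousOn (hS : IsC0Semigroup S) (T : ℝ) {K : Set X}
    (hK : IsCompact K) {η : ℝ} (hη : 0 < η) :
    ∃ δ > 0, ∀ τ ∈ Icc 0 T, ∀ τ' ∈ Icc 0 T, |τ - τ'| < δ → ∀ k ∈ K, ‖S τ k - S τ' k‖ ≤ η := by
  have huc := (isCompact_Icc.prod hK).uniformContinuousOn_of_continuous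
    ((hS.continuousOn_uncurry T).mono (prod_mono_right (subset_univ K)))
  obtain ⟨δ, hδ, h⟩ := Metric.uniformContinuousOn_iff.1 huc η hη
  refine ⟨δ, hδ, fun τ hτ τ' hτ' hd k hk => ?_⟩
  have := h (τ, k) ⟨hτ, hk⟩ (τ', k) ⟨hτ', hk⟩
    (by rw [Prod.dist_eq, dist_self, Real.dist_eq]; exact max_lt hd hδ)
  rw [dist_eq_norm] at this
  exact this.le

end Semigroup

/-! ### The convolution of a semigroup with a controlled inhomogeneity -/

section Duhamel

variable {𝕜 X : Type*} [RCLike 𝕜] [NormedAddCommGroup X] [NormedSpace 𝕜 X]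
  [NormedSpace ℝ X]

/-- The Duhamel integral `∫_0^t S(t-s) w(s) g(s) ds`, with scalar density `w` and vector-valued
integrand `g`. It has the value `0` where the integrand is not integrable. -/
noncomputable def duhamel (S : ℝ → X →L[𝕜] X) (w : ℝ → ℝ) (g : ℝ → X) (t : ℝ) : X :=
  ∫ s in (0 : ℝ)..t, S (t - s) (w s • g s)

variable {S : ℝ → X →L[𝕜] X} {T : ℝ} {m : ℕ} {p : ℝ≥0∞} [Fact (1 ≤ p)]

theorem norm_duhamel_le {M : ℝ} (hM : ∀ t ∈ Icc 0 T, ‖S t‖ ≤ M) {w ω : ℝ → ℝ}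
    (hw : ∀ᵐ s, s ∈ Icc 0 T → |w s| ≤ ω s) (hω : IntegrableOn ω (Icc 0 T)) {g : ℝ → X}
    {h : ℝ → ℝ} (hh : ContinuousOn h (Icc 0 T)) (hgh : ∀ᵐ s, s ∈ Icc 0 T → ‖g s‖ ≤ h s)
    {t : ℝ} (ht : t ∈ Icc 0 T) :
    ‖duhamel S w g t‖ ≤ M * ∫ s in (0 : ℝ)..t, ω s * h s := by
  rw [← intervalIntegral.integral_const_mul]
  refine intervalIntegral.norm_integral_le_of_norm_le ht.1 ?_ ?_
  · filter_upwards [hw, hgh] with s hws hgs hs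
    have hsT : s ∈ Icc 0 T := ⟨hs.1.le, hs.2.trans ht.2⟩
    have hts : t - s ∈ Icc 0 T := ⟨by linarith [hs.2], by linarith [hs.1, ht.2]⟩
    refine ((S (t - s)).le_of_opNorm_le (hM _ hts) _).trans ?_
    have hM0 : 0 ≤ M := (norm_nonneg _).trans (hM _ hts)
    rw [norm_smul, Real.norm_eq_abs]
    have := hws hsT
    have := hgs hsT
    have : 0 ≤ ω s := (abs_nonneg _).trans (hws hsT)
    gcongr
  · refine IntervalIntegrable.const_mul ?_ _
    rw [intervalIntegrable_iff_integrableOn_Icc_of_le ht.1]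
    exact (hω.mul_continuousOn hh isCompact_Icc).mono_set (Icc_subset_Icc_right ht.2)

/-- A weighted bound on the integrands gives a bound on the Duhamel integrals in terms of the
weighted integral of the control. -/
theorem sum_norm_duhamel_le {M : ℝ} (hM : ∀ t ∈ Icc 0 T, ‖S t‖ ≤ M) (u : Control m p T)
    {g : Fin m → ℝ → X} {c : Fin m → ℝ} {a r : ℝ}
    (hg : ∀ i, ∀ᵐ s, s ∈ Icc 0 T → ‖g i s‖ ≤ c i * (a * Real.exp (r * s))) {t : ℝ}
    (ht : t ∈ Icc 0 T) :
    ∑ i, ‖duhamel S (fun s => u s i) (g i) t‖ ≤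
      a * ((∑ i, M * c i) * ∫ s in (0 : ℝ)..t, ‖u s‖ * Real.exp (r * s)) := by
  rw [Finset.sum_mul, Finset.mul_sum]
  refine Finset.sum_le_sum fun i _ => ?_
  refine (norm_duhamel_le hM (ω := fun s => ‖u s‖) (.of_forall fun s _ => u.abs_apply_le i s)
    u.integrableOn_norm (by fun_prop) (hg i) ht).trans_eq ?_
  have : ∀ s, ‖u s‖ * (c i * (a * Real.exp (r * s))) =
      (c i * a) * (‖u s‖ * Real.exp (r * s)) := fun s => by ring
  simp_rw [this, intervalIntegral.integral_const_mul]
  ring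

variable [IsScalarTower ℝ 𝕜 X] [CompleteSpace X]

/-- Integrability is needed on `[0,t]` for the kernels `S(t' - ·)` with any `t' ≥ t`, in order to
compare Duhamel integrals at two times. -/
theorem IsC0Semigroup.intervalIntegrable_duhamel (hS : IsC0Semigroup S) {w : ℝ → ℝ}
    (hw : IntegrableOn w (Icc 0 T)) {g : ℝ → X} (hg : ContinuousOn g (Icc 0 T)) {t t' : ℝ}
    (ht : t ∈ Icc 0 T) (ht' : t' ∈ Icc t T) :
    IntervalIntegrable (fun s => S (t' - s) (w s • g s)) volume 0 t := by
  rw [intervalIntegrable_iff_integrableOn_Icc_of_le ht.1]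
  have hsub : Icc 0 t ⊆ Icc 0 T := Icc_subset_Icc_right ht.2
  have hc : ContinuousOn (fun s => S (t' - s) (g s)) (Icc 0 t) :=
    (hS.continuousOn_uncurry T).comp (f := fun s => (t' - s, g s))
      ((by fun_prop : ContinuousOn (fun s => t' - s) (Icc 0 t)).prodMk (hg.mono hsub))
      fun s hs => ⟨⟨by linarith [hs.2, ht'.1], by linarith [hs.1, ht'.2]⟩, mem_univ _⟩
  simpa only [ContinuousLinearMap.map_smul_of_tower] using
    (hw.mono_set hsub).smul_continuousOn hc isCompact_Icc

theorem duhamel_sub_duhamel (hS : IsC0Semigroup S) {w w' : ℝ → ℝ}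
    (hw : IntegrableOn w (Icc 0 T)) (hw' : IntegrableOn w' (Icc 0 T)) {g g' : ℝ → X}
    (hg : ContinuousOn g (Icc 0 T)) (hg' : ContinuousOn g' (Icc 0 T)) {t : ℝ}
    (ht : t ∈ Icc 0 T) :
    duhamel S w g t - duhamel S w' g' t =
      duhamel S w (g - g') t + duhamel S (w - w') g' t := by
  have htt := left_mem_Icc.2 ht.2
  simp only [duhamel]
  rw [← intervalIntegral.integral_sub (hS.intervalIntegrable_duhamel hw hg ht htt)
    (hS.intervalIntegrable_duhamel hw' hg' ht htt),
    ← intervalIntegral.integral_add (hS.intervalIntegrable_duhamel hw (hg.sub hg') ht htt)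
    (hS.intervalIntegrable_duhamel (hw.sub hw') hg' ht htt)]
  congr 1; ext s
  rw [← map_sub, ← map_add]
  congr 1
  simp only [Pi.sub_apply, smul_sub, sub_smul]
  abel

/-- Duhamel integrals of functions with values in a fixed compact set, against densities dominated
by a bounded set of controls, are uniformly equicontinuous: for `t ≤ t'` the increment is
`∫_t^{t'} S(t'-s) w(s) g(s) ds + ∫_0^t w(s) (S(t'-s) - S(t-s)) g(s) ds`. The first term is small by
uniform integrability, the second by equicontinuity of the orbits starting in the compact set. -/
theorem IsC0Semigroup.exists_duhamel_equicontinuous (hp : 1 < p) (hS : IsC0Semigroup S)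
    {K : Set X} (hK : IsCompact K) (R : ℝ) {ε : ℝ} (hε : 0 < ε) :
    ∃ δ > 0, ∀ u : Control m p T, ‖u‖ ≤ R → ∀ (w : ℝ → ℝ) (g : ℝ → X),
      IntegrableOn w (Icc 0 T) → (∀ s, |w s| ≤ ‖u s‖) → ContinuousOn g (Icc 0 T) →
      MapsTo g (Icc 0 T) K → ∀ t ∈ Icc 0 T, ∀ t' ∈ Icc t T, t' - t < δ →
      ‖duhamel S w g t' - duhamel S w g t‖ ≤ ε := by
  obtain ⟨M, hM, hSM⟩ := hS.exists_norm_le T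
  obtain ⟨C, hC, hKC⟩ := hK.isBounded.exists_pos_norm_le
  obtain ⟨c, hc, hcu⟩ := Control.exists_integral_le (m := m) hp T
  set R' := max R 0
  obtain ⟨δ₁, hδ₁, h₁⟩ := Control.exists_integral_small (m := m) hp T R
    (ε := ε / 2 / (M * C)) (by positivity)
  obtain ⟨δ₂, hδ₂, h₂⟩ := hS.exists_equicontinuousOn T hK
    (η := ε / 2 / (c * R' + 1)) (by positivity)
  refine ⟨min δ₁ δ₂, by positivity, fun u hu w g hw hwu hg hgK t ht t' ht' hd => ?_⟩
  have ht'T : t' ∈ Icc 0 T := ⟨ht.1.trans ht'.1, ht'.2⟩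
  have hi := u.intervalIntegrable_norm ht'T
  have hs1 : uIcc t t' ⊆ uIcc 0 t' := by
    rw [uIcc_of_le ht'.1, uIcc_of_le ht'T.1]; exact Icc_subset_Icc_left ht.1
  have hs2 : uIcc 0 t ⊆ uIcc 0 t' := by
    rw [uIcc_of_le ht.1, uIcc_of_le ht'T.1]; exact Icc_subset_Icc_right ht'.1
  have hI := hS.intervalIntegrable_duhamel hw hg ht'T (left_mem_Icc.2 ht'.2)
  have hI' := hS.intervalIntegrable_duhamel hw hg ht (left_mem_Icc.2 ht.2)
  have hsplit : duhamel S w g t' - duhamel S w g t =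
      (∫ s in t..t', S (t' - s) (w s • g s)) +
      ∫ s in (0 : ℝ)..t, (S (t' - s) (w s • g s) - S (t - s) (w s • g s)) := by
    rw [intervalIntegral.integral_sub (hI.mono_set hs2) hI', duhamel, duhamel,
      ← intervalIntegral.integral_add_adjacent_intervals (hI.mono_set hs2) (hI.mono_set hs1)]
    abel
  have hA : ‖∫ s in t..t', S (t' - s) (w s • g s)‖ ≤ ε / 2 := by
    calc _ ≤ ∫ s in t..t', M * C * ‖u s‖ := by
          refine intervalIntegral.norm_integral_le_of_norm_le ht'.1 (.of_forall fun s hs => ?_)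
            ((hi.mono_set hs1).const_mul _)
          have hsT : s ∈ Icc 0 T := ⟨ht.1.trans hs.1.le, hs.2.trans ht'.2⟩
          refine ((S (t' - s)).le_of_opNorm_le (hSM _ ⟨by linarith [hs.2],
            by linarith [hsT.1, ht'.2]⟩) _).trans ?_
          rw [norm_smul, Real.norm_eq_abs, mul_assoc, mul_comm C]
          have := hwu s
          have := hKC _ (hgK hsT)
          gcongr
      _ = M * C * ∫ s in t..t', ‖u s‖ := intervalIntegral.integral_const_mul _ _
      _ ≤ M * C * (ε / 2 / (M * C)) := by
          gcongr
          exact h₁ u hu t ht t' ht' (hd.trans_le (min_le_left _ _))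
      _ = ε / 2 := by field_simp
  have hB : ‖∫ s in (0 : ℝ)..t, (S (t' - s) (w s • g s) - S (t - s) (w s • g s))‖ ≤ ε / 2 := by
    calc _ ≤ ∫ s in (0 : ℝ)..t, ε / 2 / (c * R' + 1) * ‖u s‖ := by
          refine intervalIntegral.norm_integral_le_of_norm_le ht.1 (.of_forall fun s hs => ?_)
            ((hi.mono_set hs2).const_mul _)
          have hsT : s ∈ Icc 0 T := ⟨hs.1.le, hs.2.trans ht.2⟩
          rw [ContinuousLinearMap.map_smul_of_tower, ContinuousLinearMap.map_smul_of_tower,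
            ← smul_sub, norm_smul, Real.norm_eq_abs, mul_comm]
          have := hwu s
          have := h₂ (t' - s) ⟨by linarith [hs.2, ht'.1], by linarith [hsT.1, ht'.2]⟩ (t - s)
            ⟨by linarith [hs.2], by linarith [hsT.1, ht.2]⟩ (by
              rw [sub_sub_sub_cancel_right, abs_of_nonneg (by linarith [ht'.1])]
              exact hd.trans_le (min_le_right _ _)) _ (hgK hsT)
          gcongr
      _ = ε / 2 / (c * R' + 1) * ∫ s in (0 : ℝ)..t, ‖u s‖ :=
          intervalIntegral.integral_const_mul _ _
      _ ≤ ε / 2 / (c * R' + 1) * (c * R' + 1) := by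
          have : ‖u‖ ≤ R' := hu.trans (le_max_left _ _)
          have : c * ‖u‖ ≤ c * R' := by gcongr
          gcongr
          linarith [hcu u t ht]
      _ = ε / 2 := div_mul_cancel₀ _ (by positivity)
  rw [hsplit]
  exact (norm_add_le _ _).trans (by linarith)

theorem IsC0Semigroup.continuousOn_duhamel (hp : 1 < p) (hS : IsC0Semigroup S)
    (u : Control m p T) (i : Fin m) {g : ℝ → X} (hg : ContinuousOn g (Icc 0 T)) :
    ContinuousOn (duhamel S (fun s => u s i) g) (Icc 0 T) := by
  refine Metric.continuousOn_iff.2 fun t ht ε hε => ?_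
  obtain ⟨δ, hδ, h⟩ := hS.exists_duhamel_equicontinuous (m := m) hp
    (isCompact_Icc.image_of_continuousOn hg) ‖u‖ (half_pos hε)
  refine ⟨δ, hδ, fun t' ht' hd => ?_⟩
  have key := h u le_rfl _ g (u.integrableOn_apply i) (u.abs_apply_le i) hg (mapsTo_image _ _)
  rw [Real.dist_eq] at hd
  refine lt_of_le_of_lt ?_ (half_lt_self hε)
  rcases le_total t t' with hle | hle
  · rw [dist_eq_norm]
    exact key t ht t' ⟨hle, ht'.2⟩ ((le_abs_self _).trans_lt hd)
  · rw [dist_comm, dist_eq_norm]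
    exact key t' ht' t ⟨hle, ht.2⟩ ((le_abs_self _).trans_lt (by rwa [abs_sub_comm]))

/-- Duhamel integrals of functions with values in a fixed compact set, against densities dominated
by a bounded set of controls, stay in a compact set. -/
theorem IsC0Semigroup.exists_isCompact_duhamel_mem (hp : 1 < p) (hS : IsC0Semigroup S)
    {K : Set X} (hK : IsCompact K) (R : ℝ) :
    ∃ K' : Set X, IsCompact K' ∧ ∀ u : Control m p T, ‖u‖ ≤ R → ∀ (w : ℝ → ℝ) (g : ℝ → X),
      IntegrableOn w (Icc 0 T) → (∀ s, |w s| ≤ ‖u s‖) → ContinuousOn g (Icc 0 T) →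
      MapsTo g (Icc 0 T) K → ∀ t ∈ Icc 0 T, duhamel S w g t ∈ K' := by
  obtain ⟨c, hc, hcu⟩ := Control.exists_integral_le (m := m) hp T
  set R' := max R 0
  set H := (fun q : ℝ × X => S q.1 q.2) '' (Icc 0 T ×ˢ K)
  have hH : IsCompact H := (isCompact_Icc.prod hK).image_of_continuousOn
    ((hS.continuousOn_uncurry T).mono (prod_mono_right (subset_univ K)))
  refine ⟨(c * R' + 1) • closedAbsConvexHull ℝ H,
    (isCompact_closedAbsConvexHull_of_totallyBounded hH.totallyBounded).smul _,
    fun u hu w g hw hwu hg hgK t ht => ?_⟩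
  have hi := u.intervalIntegrable_norm ht
  have hint := hS.intervalIntegrable_duhamel hw hg ht (left_mem_Icc.2 ht.2)
  simp only [duhamel, ContinuousLinearMap.map_smul_of_tower] at hint ⊢
  have hmem : ∀ s ∈ Icc 0 t, S (t - s) (g s) ∈ H := fun s hs =>
    ⟨(t - s, g s), ⟨⟨by linarith [hs.2], by linarith [hs.1, ht.2]⟩,
      hgK ⟨hs.1, hs.2.trans ht.2⟩⟩, rfl⟩
  refine intervalIntegral_mem_smul_closedAbsConvexHull hH ht.1 (by positivity) hi hwu ?_
    ⟨_, hmem 0 (left_mem_Icc.2 ht.1)⟩ (fun s hs => hmem s (Ioc_subset_Icc_self hs)) hint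
  have : ‖u‖ ≤ R' := hu.trans (le_max_left _ _)
  have : c * ‖u‖ ≤ c * R' := by gcongr
  linarith [hcu u t ht]

end Duhamel

/-! ### The nonlinearities along a trajectory -/

section Superposition

variable {X : Type*} [NormedAddCommGroup X] {T : ℝ} {m : ℕ} {f : Fin m → ℝ → X → X}

theorem LinearlyBounded.exists_ae_le {g : ℝ → X → X} (hg : LinearlyBounded g) (T : ℝ) :
    ∃ c : ℝ, 0 ≤ c ∧ ∀ᵐ s, s ∈ Icc 0 T → ∀ ξ, ‖g s ξ‖ ≤ c * (‖ξ‖ + 1) := by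
  obtain ⟨α, β, hα, hβ, h⟩ := hg
  obtain ⟨cα, hcα, hα⟩ := hα.exists_ae_le T
  obtain ⟨cβ, hcβ, hβ⟩ := hβ.exists_ae_le T
  refine ⟨cα + cβ, by positivity, ?_⟩
  filter_upwards [hα, hβ] with s hαs hβs hs ξ
  have h1 : α s * ‖ξ‖ ≤ cα * ‖ξ‖ := mul_le_mul_of_nonneg_right (hαs hs) (norm_nonneg _)
  nlinarith [h s hs.1 ξ, hβs hs, norm_nonneg ξ]

theorem LipschitzOnBoundedSets.exists_ae_le {g : ℝ → X → X} (hg : LipschitzOnBoundedSets g)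
    (T ρ : ℝ) :
    ∃ L : ℝ, 0 ≤ L ∧ ∀ᵐ s, s ∈ Icc 0 T → ∀ ξ η, ‖ξ‖ ≤ ρ → ‖η‖ ≤ ρ →
      ‖g s ξ - g s η‖ ≤ L * ‖ξ - η‖ := by
  obtain ⟨L, hL, h⟩ := hg (Metric.closedBall 0 ρ) Metric.isBounded_closedBall
  obtain ⟨c, hc, hLc⟩ := hL.exists_ae_le T
  refine ⟨c, hc, ?_⟩
  filter_upwards [hLc] with s hLs hs ξ η hξ hη
  exact (h s hs.1 ξ (by simpa using hξ) η (by simpa using hη)).trans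
    (mul_le_mul_of_nonneg_right (hLs hs) (norm_nonneg _))

theorem continuousOn_comp_IccExtend
    (hf : ∀ i, ContinuousOn (fun q : ℝ × X => f i q.1 q.2) (Ici 0 ×ˢ univ)) (hT : 0 ≤ T)
    (x : C(Icc (0 : ℝ) T, X)) (i : Fin m) :
    ContinuousOn (fun s => f i s (IccExtend hT x s)) (Icc 0 T) :=
  (hf i).comp (f := fun s => (s, IccExtend hT x s))
    (continuous_id.prodMk x.continuous.Icc_extend').continuousOn
    fun _ hs => ⟨hs.1, mem_univ _⟩

/-- Along trajectories with values in `K`, one compact set holds the values of all nonlinearities. -/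
theorem isCompact_iUnion_image
    (hf : ∀ i, ContinuousOn (fun q : ℝ × X => f i q.1 q.2) (Ici 0 ×ˢ univ)) (T : ℝ)
    {K : Set X} (hK : IsCompact K) :
    IsCompact (⋃ i, (fun q : ℝ × X => f i q.1 q.2) '' (Icc 0 T ×ˢ K)) :=
  isCompact_iUnion fun i => (isCompact_Icc.prod hK).image_of_continuousOn
    ((hf i).mono (prod_mono Icc_subset_Ici_self (subset_univ K)))

theorem mapsTo_iUnion_image (hT : 0 ≤ T) {K : Set X} {x : C(Icc (0 : ℝ) T, X)} (hx : ∀ t, x t ∈ K)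
    (i : Fin m) : MapsTo (fun s => f i s (IccExtend hT x s)) (Icc 0 T)
      (⋃ i, (fun q : ℝ × X => f i q.1 q.2) '' (Icc 0 T ×ˢ K)) := fun s hs =>
  mem_iUnion.2 ⟨i, (s, IccExtend hT x s), ⟨hs, hx _⟩, rfl⟩

end Superposition

/-! ### The Picard operator and its fixed points -/

section Picard

variable {𝕜 X : Type*} [RCLike 𝕜] [NormedAddCommGroup X] [NormedSpace 𝕜 X]
  [NormedSpace ℝ X] [IsScalarTower ℝ 𝕜 X] [CompleteSpace X] {S : ℝ → X →L[𝕜] X} {T : ℝ}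
  {m : ℕ} {p : ℝ≥0∞} [Fact (1 ≤ p)] {f : Fin m → ℝ → X → X}

/-- The Picard operator `x ↦ S(·) ξ₀ + ∑ i, ∫_0^· S(· - s) u_i(s) f_i(s, x(s)) ds` on `C([0,T], X)`.
The hypotheses enter as arguments because they guarantee that the image is continuous. As in
`IsMildSolution`, `IccExtend hT x` extends `x` to the real line. -/
noncomputable def picard (hp : 1 < p) (hT : 0 ≤ T) (hS : IsC0Semigroup S)
    (hf : ∀ i, ContinuousOn (fun q : ℝ × X => f i q.1 q.2) (Ici 0 ×ˢ univ)) (ξ₀ : X)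
    (u : Control m p T) (x : C(Icc (0 : ℝ) T, X)) : C(Icc (0 : ℝ) T, X) where
  toFun t := S t ξ₀ + ∑ i, duhamel S (fun s => u s i) (fun s => f i s (IccExtend hT x s)) t
  continuous_toFun := by
    refine Continuous.add ?_ (continuous_finsetSum _ fun i _ => ?_)
    · exact continuousOn_iff_continuous_domRestrict.1
        ((hS.strongly_continuous ξ₀).mono Icc_subset_Ici_self)
    · exact continuousOn_iff_continuous_domRestrict.1
        (hS.continuousOn_duhamel hp u i (continuousOn_comp_IccExtend hf hT x i))

variable (hp : 1 < p) (hT : 0 ≤ T) (hS : IsC0Semigroup S)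
  (hf : ∀ i, ContinuousOn (fun q : ℝ × X => f i q.1 q.2) (Ici 0 ×ˢ univ)) (ξ₀ : X)

theorem isMildSolution_iff_picard_eq (u : Control m p T) (x : C(Icc (0 : ℝ) T, X)) :
    IsMildSolution hT S f ξ₀ u x ↔ picard hp hT hS hf ξ₀ u x = x := by
  constructor
  · intro h
    ext t
    exact (h t).2.symm
  · intro h t
    refine ⟨fun i => hS.intervalIntegrable_duhamel (u.integrableOn_apply i)
      (continuousOn_comp_IccExtend hf hT x i) t.2 (left_mem_Icc.2 t.2.2), ?_⟩
    conv_lhs => rw [← h]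
    rfl

/-- Linear growth of the nonlinearities in weighted form. The rate `r` is uniform over controls of
norm at most `R`. -/
theorem exists_norm_picard_le (hf2 : ∀ i, LinearlyBounded (f i)) (R : ℝ) :
    ∃ r b : ℝ, 0 < r ∧ 0 ≤ b ∧ ∀ u : Control m p T, ‖u‖ ≤ R →
      ∀ (x : C(Icc (0 : ℝ) T, X)) (a : ℝ), 0 ≤ a → (∀ t, ‖x t‖ ≤ a * Real.exp (r * t)) →
      ∀ t, ‖picard hp hT hS hf ξ₀ u x t‖ ≤ (a / 2 + b) * Real.exp (r * t) := by
  obtain ⟨M, hM, hSM⟩ := hS.exists_norm_le T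
  choose c hc hfc using fun i => (hf2 i).exists_ae_le T
  have hκ0 : 0 ≤ ∑ i, M * c i := Finset.sum_nonneg fun i _ => by have := hc i; positivity
  obtain ⟨r, hr, h⟩ := Control.exists_mul_weight_integral_le_half (m := m) hp T R hκ0
  refine ⟨r, M * ‖ξ₀‖ + 1, hr, by positivity, fun u hu x a ha hx t => ?_⟩
  have hduh := sum_norm_duhamel_le hSM u (g := fun i s => f i s (IccExtend hT x s)) (c := c)
    (a := a + 1) (r := r) (fun i => ?_) t.2
  · have hexp : 1 ≤ Real.exp (r * t) := Real.one_le_exp (mul_nonneg hr.le t.2.1)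
    have hω := mul_le_mul_of_nonneg_left (h u hu t t.2) (by linarith : 0 ≤ a + 1)
    have hS0 : ‖S t ξ₀‖ ≤ M * ‖ξ₀‖ := (S t).le_of_opNorm_le (hSM t t.2) _
    have hM0 : M * ‖ξ₀‖ ≤ M * ‖ξ₀‖ * Real.exp (r * t) :=
      le_mul_of_one_le_right (by positivity) hexp
    calc ‖picard hp hT hS hf ξ₀ u x t‖ ≤ ‖S t ξ₀‖ +
          ∑ i, ‖duhamel S (fun s => u s i) (fun s => f i s (IccExtend hT x s)) t‖ :=
          (norm_add_le _ _).trans (by gcongr; exact norm_sum_le _ _)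
      _ ≤ _ := by linarith
  · filter_upwards [hfc i] with s hs hsT
    have h2 : ‖IccExtend hT x s‖ ≤ a * Real.exp (r * s) := by
      rw [IccExtend_of_mem hT x hsT]; exact hx ⟨s, hsT⟩
    have h3 : 1 ≤ Real.exp (r * s) := Real.one_le_exp (mul_nonneg hr.le hsT.1)
    exact (hs hsT _).trans (mul_le_mul_of_nonneg_left (by linarith) (hc i))

/-- The Picard operator halves weighted distances between functions bounded by `ρ`, and depends on
the control in a Lipschitz way. Only the control multiplying the difference of the nonlinearities
has to be bounded by `R`. -/
theorem exists_norm_picard_sub_picard_le (hf1 : ∀ i, LipschitzOnBoundedSets (f i))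
    (hf2 : ∀ i, LinearlyBounded (f i)) (R ρ : ℝ) :
    ∃ r C : ℝ, 0 < r ∧ 0 ≤ C ∧ ∀ u v : Control m p T, ‖u‖ ≤ R → ∀ x y : C(Icc (0 : ℝ) T, X),
      (∀ t, ‖x t‖ ≤ ρ) → (∀ t, ‖y t‖ ≤ ρ) → ∀ a, 0 ≤ a →
      (∀ t, ‖x t - y t‖ ≤ a * Real.exp (r * t)) →
      ∀ t, ‖picard hp hT hS hf ξ₀ u x t - picard hp hT hS hf ξ₀ v y t‖ ≤
        (a / 2 + C * ‖u - v‖) * Real.exp (r * t) := by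
  obtain ⟨M, hM, hSM⟩ := hS.exists_norm_le T
  obtain ⟨c₁, hc₁, hcu⟩ := Control.exists_integral_le (m := m) hp T
  choose L hL hfL using fun i => (hf1 i).exists_ae_le T ρ
  choose c' hc' hfc' using fun i => (hf2 i).exists_ae_le T
  obtain ⟨c, hc, hfc⟩ : ∃ c : Fin m → ℝ, (∀ i, 0 ≤ c i) ∧
      ∀ i, ∀ᵐ s, s ∈ Icc 0 T → ∀ ξ, ‖ξ‖ ≤ ρ → ‖f i s ξ‖ ≤ c i := by
    refine ⟨fun i => c' i * (max ρ 0 + 1), fun i => mul_nonneg (hc' i) (by positivity),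
      fun i => ?_⟩
    filter_upwards [hfc' i] with s hs hsT ξ hξ
    exact (hs hsT ξ).trans (mul_le_mul_of_nonneg_left (by linarith [le_max_left ρ 0]) (hc' i))
  have hκ0 : 0 ≤ ∑ i, M * L i := Finset.sum_nonneg fun i _ => by have := hL i; positivity
  obtain ⟨r, hr, h⟩ := Control.exists_mul_weight_integral_le_half (m := m) hp T R hκ0
  refine ⟨r, ∑ i, M * c i * c₁, hr,
    Finset.sum_nonneg fun i _ => by have := hc i; positivity, fun u v hu x y hx hy a ha hxy t => ?_⟩
  have hxs : ∀ s, ‖IccExtend hT x s‖ ≤ ρ := fun s => hx _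
  have hys : ∀ s, ‖IccExtend hT y s‖ ≤ ρ := fun s => hy _
  have hA : ∑ i, ‖duhamel S (fun s => u s i)
      ((fun s => f i s (IccExtend hT x s)) - fun s => f i s (IccExtend hT y s)) t‖ ≤
      a * (1 / 2 * Real.exp (r * t)) := by
    refine (sum_norm_duhamel_le hSM u (c := L) (a := a) (r := r) (fun i => ?_) t.2).trans
      (mul_le_mul_of_nonneg_left (h u hu t t.2) ha)
    filter_upwards [hfL i] with s hs hsT
    refine (hs hsT _ _ (hxs s) (hys s)).trans (mul_le_mul_of_nonneg_left ?_ (hL i))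
    rw [IccExtend_of_mem hT x hsT, IccExtend_of_mem hT y hsT]
    exact hxy ⟨s, hsT⟩
  have hB : ∀ i, ‖duhamel S ((fun s => u s i) - fun s => v s i)
      (fun s => f i s (IccExtend hT y s)) t‖ ≤ M * c i * c₁ * ‖u - v‖ := by
    intro i
    refine (norm_duhamel_le hSM (ω := fun s => ‖(u - v : Control m p T) s‖) ?_
      (u - v).integrableOn_norm (h := fun _ => c i) (by fun_prop) ?_ t.2).trans ?_
    -- The coordinates of `u - v` are differences of coordinates only almost everywhere.
    · have hsub := Lp.coeFn_sub u v
      rw [EventuallyEq, ae_restrict_iff' measurableSet_Icc] at hsub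
      filter_upwards [hsub] with s hs hsT
      have h1 := Control.abs_apply_le (u - v) i s
      rw [hs hsT] at h1 ⊢
      exact h1
    · filter_upwards [hfc i] with s hs hsT
      exact hs hsT _ (hys s)
    · rw [intervalIntegral.integral_mul_const]
      have h1 := hcu (u - v) t t.2
      have := hc i
      calc _ ≤ M * (c₁ * ‖u - v‖ * c i) := by gcongr
        _ = _ := by ring
  have hexp : 1 ≤ Real.exp (r * t) := Real.one_le_exp (mul_nonneg hr.le t.2.1)
  have hsplit : picard hp hT hS hf ξ₀ u x t - picard hp hT hS hf ξ₀ v y t =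
      ∑ i, (duhamel S (fun s => u s i)
        ((fun s => f i s (IccExtend hT x s)) - fun s => f i s (IccExtend hT y s)) t +
      duhamel S ((fun s => u s i) - fun s => v s i) (fun s => f i s (IccExtend hT y s)) t) := by
    simp only [picard, ContinuousMap.coe_mk, add_sub_add_left_eq_sub, ← Finset.sum_sub_distrib]
    exact Finset.sum_congr rfl fun i _ => duhamel_sub_duhamel hS (u.integrableOn_apply i)
      (v.integrableOn_apply i) (continuousOn_comp_IccExtend hf hT x i)
      (continuousOn_comp_IccExtend hf hT y i) t.2
  have hC : (∑ i, M * c i * c₁) * ‖u - v‖ ≤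
      (∑ i, M * c i * c₁) * ‖u - v‖ * Real.exp (r * t) := by
    refine le_mul_of_one_le_right (mul_nonneg (Finset.sum_nonneg fun i _ => ?_)
      (norm_nonneg _)) hexp
    have := hc i
    positivity
  calc ‖picard hp hT hS hf ξ₀ u x t - picard hp hT hS hf ξ₀ v y t‖ ≤
        a * (1 / 2 * Real.exp (r * t)) + (∑ i, M * c i * c₁) * ‖u - v‖ := by
        rw [hsplit, Finset.sum_add_distrib]
        refine (norm_add_le _ _).trans (add_le_add ((norm_sum_le _ _).trans hA) ?_)
        rw [Finset.sum_mul]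
        exact (norm_sum_le _ _).trans (Finset.sum_le_sum fun i _ => hB i)
    _ ≤ _ := by linarith

/-- A priori bound: the Picard iterates of `0` and all fixed points are bounded, uniformly over
bounded sets of controls. -/
theorem exists_norm_iterate_picard_le (hf2 : ∀ i, LinearlyBounded (f i)) (R : ℝ) :
    ∃ ρ : ℝ, ∀ u : Control m p T, ‖u‖ ≤ R →
      (∀ k t, ‖(picard hp hT hS hf ξ₀ u)^[k] 0 t‖ ≤ ρ) ∧
      ∀ x, picard hp hT hS hf ξ₀ u x = x → ∀ t, ‖x t‖ ≤ ρ := by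
  obtain ⟨r, b, hr, hb, h⟩ := exists_norm_picard_le hp hT hS hf ξ₀ hf2 R
  have hexp : ∀ t : Icc 0 T, 2 * b * Real.exp (r * t) ≤ 2 * b * Real.exp (r * T) := fun t => by
    have := t.2.2
    gcongr
  refine ⟨2 * b * Real.exp (r * T), fun u hu => ⟨fun k t => ?_, fun x hx t => ?_⟩⟩
  · suffices ∀ t, ‖(picard hp hT hS hf ξ₀ u)^[k] 0 t‖ ≤ 2 * b * Real.exp (r * t) from
      (this t).trans (hexp t)
    induction k with
    | zero => intro t; simp only [Function.iterate_zero, id]; simp; positivity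
    | succ k ih =>
      intro t
      rw [Function.iterate_succ_apply']
      exact (h u hu _ _ (by positivity) ih t).trans_eq (by ring)
  · refine (norm_le_of_forall_weighted_le hT x (r := r) (b := b) (fun a ha hxa t => ?_) t).trans
      (hexp t)
    have := h u hu x a ha hxa t
    rwa [hx] at this

theorem exists_norm_iterate_picard_sub_le (hf1 : ∀ i, LipschitzOnBoundedSets (f i))
    (hf2 : ∀ i, LinearlyBounded (f i)) (R ρ : ℝ) :
    ∃ C : ℝ, ∀ u : Control m p T, ‖u‖ ≤ R → ∀ x y : C(Icc (0 : ℝ) T, X),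
      (∀ k t, ‖(picard hp hT hS hf ξ₀ u)^[k] x t‖ ≤ ρ) →
      (∀ k t, ‖(picard hp hT hS hf ξ₀ u)^[k] y t‖ ≤ ρ) → ∀ k,
      dist ((picard hp hT hS hf ξ₀ u)^[k] x) ((picard hp hT hS hf ξ₀ u)^[k] y) ≤
        C * (1 / 2) ^ k := by
  obtain ⟨r, C, hr, hC, h⟩ := exists_norm_picard_sub_picard_le (m := m) hp hT hS hf ξ₀ hf1 hf2 R ρ
  refine ⟨2 * ρ * Real.exp (r * T), fun u hu x y hx hy k => ?_⟩
  have hρ : 0 ≤ ρ := (norm_nonneg _).trans (hx 0 ⟨0, left_mem_Icc.2 hT⟩)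
  rw [ContinuousMap.dist_le (by positivity)]
  suffices ∀ t, ‖(picard hp hT hS hf ξ₀ u)^[k] x t - (picard hp hT hS hf ξ₀ u)^[k] y t‖ ≤
      2 * ρ * (1 / 2) ^ k * Real.exp (r * t) by
    intro t
    rw [dist_eq_norm]
    refine (this t).trans ?_
    rw [mul_right_comm]
    have := t.2.2
    gcongr
  induction k with
  | zero =>
    intro t
    have h1 := norm_sub_le ((picard hp hT hS hf ξ₀ u)^[0] x t)
      ((picard hp hT hS hf ξ₀ u)^[0] y t)
    have h2 : 1 ≤ Real.exp (r * t) := Real.one_le_exp (mul_nonneg hr.le t.2.1)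
    rw [pow_zero, mul_one]
    nlinarith [hx 0 t, hy 0 t]
  | succ k ih =>
    intro t
    simp only [Function.iterate_succ_apply']
    refine (h u u hu _ _ (hx k) (hy k) _ (by positivity) ih t).trans_eq ?_
    rw [sub_self, norm_zero]
    ring

theorem exists_picard_eq_self (hf1 : ∀ i, LipschitzOnBoundedSets (f i))
    (hf2 : ∀ i, LinearlyBounded (f i)) (u : Control m p T) :
    ∃ x, picard hp hT hS hf ξ₀ u x = x := by
  obtain ⟨ρ, hρ⟩ := exists_norm_iterate_picard_le (m := m) (p := p) hp hT hS hf ξ₀ hf2 ‖u‖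
  replace hρ := (hρ u le_rfl).1
  obtain ⟨C, hC⟩ := exists_norm_iterate_picard_sub_le (m := m) hp hT hS hf ξ₀ hf1 hf2 ‖u‖ ρ
  set P := picard hp hT hS hf ξ₀ u
  have hcauchy : CauchySeq fun k => P^[k] 0 :=
    cauchySeq_of_le_geometric (1 / 2) C (by norm_num) fun k => by
      rw [Function.iterate_succ_apply]
      exact hC u le_rfl 0 (P 0) hρ (fun k t => hρ (k + 1) t) k
  obtain ⟨z, hz⟩ := cauchySeq_tendsto_of_complete hcauchy
  have hzρ : ∀ t, ‖z t‖ ≤ ρ := fun t =>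
    le_of_tendsto (((ContinuousEvalConst.continuous_eval_const t).tendsto z).comp hz).norm
      (.of_forall fun k => hρ k t)
  obtain ⟨r, C', hr, hC', h⟩ :=
    exists_norm_picard_sub_picard_le (m := m) hp hT hS hf ξ₀ hf1 hf2 ‖u‖ ρ
  have hPz : Tendsto (fun k => P (P^[k] 0)) atTop (𝓝 (P z)) := by
    rw [tendsto_iff_dist_tendsto_zero] at hz ⊢
    refine squeeze_zero (fun _ => dist_nonneg) (fun k => ?_)
      (by simpa using hz.mul_const (1 / 2 * Real.exp (r * T)))
    rw [ContinuousMap.dist_le (by positivity)]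
    intro t
    rw [dist_eq_norm]
    refine (h u u le_rfl _ _ (hρ k) hzρ (dist (P^[k] 0) z) dist_nonneg (fun t => ?_) t).trans ?_
    · rw [← dist_eq_norm]
      exact (ContinuousMap.dist_apply_le_dist t).trans
        (le_mul_of_one_le_right dist_nonneg (Real.one_le_exp (mul_nonneg hr.le t.2.1)))
    · rw [sub_self, norm_zero, mul_zero, add_zero, div_eq_mul_one_div, mul_assoc]
      have := t.2.2
      gcongr
      norm_num
  refine ⟨z, tendsto_nhds_unique hPz ?_⟩
  simpa only [Function.comp_def, Function.iterate_succ_apply'] using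
    hz.comp (tendsto_add_atTop_nat 1)

/-- Lipschitz dependence of fixed points on the control. With `u = v` this is uniqueness. -/
theorem exists_dist_le_of_picard_eq_self (hf1 : ∀ i, LipschitzOnBoundedSets (f i))
    (hf2 : ∀ i, LinearlyBounded (f i)) (R : ℝ) :
    ∃ C : ℝ, 0 ≤ C ∧ ∀ u v : Control m p T, ‖u‖ ≤ R → ‖v‖ ≤ R → ∀ x y,
      picard hp hT hS hf ξ₀ u x = x → picard hp hT hS hf ξ₀ v y = y →
      dist x y ≤ C * dist u v := by
  obtain ⟨ρ, hρ⟩ := exists_norm_iterate_picard_le (m := m) (p := p) hp hT hS hf ξ₀ hf2 R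
  obtain ⟨r, C, hr, hC, h⟩ := exists_norm_picard_sub_picard_le (m := m) hp hT hS hf ξ₀ hf1 hf2 R ρ
  refine ⟨2 * C * Real.exp (r * T), by positivity, fun u v hu hv x y hx hy => ?_⟩
  rw [ContinuousMap.dist_le (by positivity)]
  intro t
  have key := norm_le_of_forall_weighted_le hT (x - y) (r := r) (b := C * ‖u - v‖)
    (fun a ha hxa t => by
      have := h u v hu x y ((hρ u hu).2 x hx) ((hρ v hv).2 y hy) a ha hxa t
      rwa [hx, hy] at this) t
  rw [dist_eq_norm, dist_eq_norm]
  refine key.trans ?_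
  have := t.2.2
  calc 2 * (C * ‖u - v‖) * Real.exp (r * t) ≤ 2 * (C * ‖u - v‖) * Real.exp (r * T) := by gcongr
    _ = _ := by ring

/-! ### Compactness of the solution operator -/

theorem exists_isCompact_picard_mem (R : ℝ) {K : Set X} (hK : IsCompact K) :
    ∃ K' : Set X, IsCompact K' ∧ ∀ u : Control m p T, ‖u‖ ≤ R → ∀ x : C(Icc (0 : ℝ) T, X),
      (∀ t, x t ∈ K) → ∀ t, picard hp hT hS hf ξ₀ u x t ∈ K' := by
  obtain ⟨K', hK', h⟩ := hS.exists_isCompact_duhamel_mem (m := m) (T := T) hp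
    (isCompact_iUnion_image hf T hK) R
  refine ⟨(fun t => S t ξ₀) '' Icc 0 T + (fun z : Fin m → X => ∑ i, z i) '' univ.pi fun _ => K',
    ?_, fun u hu x hx t => ?_⟩
  · refine IsCompact.add (isCompact_Icc.image_of_continuousOn
      ((hS.strongly_continuous ξ₀).mono Icc_subset_Ici_self)) ?_
    exact (isCompact_univ_pi fun _ => hK').image (by fun_prop)
  · refine add_mem_add (mem_image_of_mem _ t.2) ⟨fun i => _, fun i _ => ?_, rfl⟩
    exact h u hu _ _ (u.integrableOn_apply i) (u.abs_apply_le i)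
      (continuousOn_comp_IccExtend hf hT x i) (mapsTo_iUnion_image hT hx i) t t.2

theorem exists_picard_equicontinuous (R : ℝ) {K : Set X} (hK : IsCompact K) {ε : ℝ}
    (hε : 0 < ε) :
    ∃ δ > 0, ∀ u : Control m p T, ‖u‖ ≤ R → ∀ x : C(Icc (0 : ℝ) T, X), (∀ t, x t ∈ K) →
      ∀ t t', dist t t' < δ →
        dist (picard hp hT hS hf ξ₀ u x t) (picard hp hT hS hf ξ₀ u x t') < ε := by
  obtain ⟨δ₁, hδ₁, h₁⟩ := hS.exists_duhamel_equicontinuous (m := m) (T := T) hp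
    (isCompact_iUnion_image hf T hK) R (ε := ε / (2 * (m + 1))) (by positivity)
  obtain ⟨δ₂, hδ₂, h₂⟩ := hS.exists_equicontinuousOn T (isCompact_singleton (x := ξ₀))
    (η := ε / 4) (by positivity)
  refine ⟨min δ₁ δ₂, by positivity, fun u hu x hx t t' hd => ?_⟩
  wlog hle : t' ≤ t generalizing t t'
  · rw [dist_comm] at hd ⊢
    exact this t' t hd (le_of_not_ge hle)
  rw [Subtype.dist_eq, Real.dist_eq] at hd
  have hduh : ∀ i, ‖duhamel S (fun s => u s i) (fun s => f i s (IccExtend hT x s)) t -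
      duhamel S (fun s => u s i) (fun s => f i s (IccExtend hT x s)) t'‖ ≤ ε / (2 * (m + 1)) :=
    fun i => h₁ u hu _ _ (u.integrableOn_apply i) (u.abs_apply_le i)
      (continuousOn_comp_IccExtend hf hT x i) (mapsTo_iUnion_image hT hx i) t' t'.2 t
      ⟨hle, t.2.2⟩ ((le_abs_self _).trans_lt (hd.trans_le (min_le_left _ _)))
  have hS' := h₂ t t.2 t' t'.2 (hd.trans_le (min_le_right _ _)) ξ₀ (mem_singleton ξ₀)
  rw [dist_eq_norm]
  simp only [picard, ContinuousMap.coe_mk]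
  rw [add_sub_add_comm, ← Finset.sum_sub_distrib]
  calc _ ≤ ε / 4 + ∑ _i : Fin m, ε / (2 * (m + 1)) :=
        (norm_add_le _ _).trans (add_le_add hS'
          ((norm_sum_le _ _).trans (Finset.sum_le_sum fun i _ => hduh i)))
    _ = ε / 4 + ε / 2 * (m / (m + 1)) := by
        rw [Finset.sum_const, Finset.card_univ, Fintype.card_fin, nsmul_eq_mul]
        field_simp
    _ ≤ ε / 4 + ε / 2 * 1 := by
        gcongr
        rw [div_le_one (by positivity)]
        linarith
    _ < ε := by linarith

/-- Bounded sets of controls have relatively compact sets of solutions: the values of the solutions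
are uniform limits of values of Picard iterates of `0`, and each iterate takes its values in
a compact set. -/
theorem isCompact_closure_image_of_picard_eq_self (hf1 : ∀ i, LipschitzOnBoundedSets (f i))
    (hf2 : ∀ i, LinearlyBounded (f i)) {Φ : Control m p T → C(Icc (0 : ℝ) T, X)}
    (hΦ : ∀ u, picard hp hT hS hf ξ₀ u (Φ u) = Φ u) {R : ℝ} {B : Set (Control m p T)}
    (hB : ∀ u ∈ B, ‖u‖ ≤ R) : IsCompact (closure (Φ '' B)) := by
  obtain ⟨ρ, hρ⟩ := exists_norm_iterate_picard_le (m := m) (p := p) hp hT hS hf ξ₀ hf2 R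
  obtain ⟨C, hC⟩ := exists_norm_iterate_picard_sub_le (m := m) hp hT hS hf ξ₀ hf1 hf2 R ρ
  have hiter : ∀ k, ∃ K : Set X, IsCompact K ∧ ∀ u : Control m p T, ‖u‖ ≤ R →
      ∀ t, (picard hp hT hS hf ξ₀ u)^[k] 0 t ∈ K := by
    intro k
    induction k with
    | zero => exact ⟨{0}, isCompact_singleton, fun _ _ _ => rfl⟩
    | succ k ih =>
      obtain ⟨K, hK, h⟩ := ih
      obtain ⟨K', hK', h'⟩ := exists_isCompact_picard_mem (m := m) (p := p) hp hT hS hf ξ₀ R hK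
      refine ⟨K', hK', fun u hu t => ?_⟩
      rw [Function.iterate_succ_apply']
      exact h' u hu _ (h u hu) t
  have hvalues : IsCompact (closure {w | ∃ u ∈ B, ∃ t, Φ u t = w}) := by
    refine isCompact_closure_of_forall_exists_isCompact fun ε hε => ?_
    have hlim : Tendsto (fun k : ℕ => C * (1 / 2 : ℝ) ^ k) atTop (𝓝 0) := by
      simpa using (tendsto_pow_atTop_nhds_zero_of_lt_one (by norm_num : (0 : ℝ) ≤ 1 / 2)
        (by norm_num)).const_mul C
    obtain ⟨k, hk⟩ := (hlim.eventually_lt_const hε).exists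
    obtain ⟨K, hK, h⟩ := hiter k
    refine ⟨K, hK, ?_⟩
    rintro _ ⟨u, hu, t, rfl⟩
    refine ⟨_, h u (hB u hu) t, ?_⟩
    -- A solution is its own Picard iterate, so comparing it with the iterates of `0` is a special
    -- case of the geometric estimate.
    have hfix : ∀ k, (picard hp hT hS hf ξ₀ u)^[k] (Φ u) = Φ u :=
      fun k => Function.iterate_fixed (hΦ u) k
    have := hC u (hB u hu) (Φ u) 0
      (fun k t => by rw [hfix]; exact (hρ u (hB u hu)).2 _ (hΦ u) t) (hρ u (hB u hu)).1 k
    rw [hfix] at this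
    exact ((ContinuousMap.dist_apply_le_dist t).trans this).trans_lt hk
  have hmem : ∀ u ∈ B, ∀ t, Φ u t ∈ closure {w | ∃ u ∈ B, ∃ t, Φ u t = w} :=
    fun u hu t => subset_closure ⟨u, hu, t, rfl⟩
  refine isCompact_closure_of_uniformEquicontinuous hvalues ?_ fun ε hε => ?_
  · rintro _ ⟨u, hu, rfl⟩
    exact hmem u hu
  · obtain ⟨δ, hδ, h⟩ :=
      exists_picard_equicontinuous (m := m) (p := p) hp hT hS hf ξ₀ R hvalues hε
    refine ⟨δ, hδ, ?_⟩
    rintro _ ⟨u, hu, rfl⟩ t t' hd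
    have := h u (hB u hu) (Φ u) (hmem u hu) t t' hd
    rwa [hΦ] at this

end Picard

end SemilinearControl

open SemilinearControl in
theorem theorem3p1 {𝕜 X : Type*} [RCLike 𝕜] [NormedAddCommGroup X] [NormedSpace 𝕜 X]
    [NormedSpace ℝ X] [IsScalarTower ℝ 𝕜 X] [CompleteSpace X]
    (A : X →ₗ.[𝕜] X) (S : ℝ → X →L[𝕜] X) (hS : IsC0Semigroup S) (hA : IsGenerator A S)
    (p : ℝ≥0∞) [Fact (1 ≤ p)] (hp : 1 < p)
    (m : ℕ) (f : Fin m → ℝ → X → X)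
    (hf : ∀ i, ContinuousOn (fun q : ℝ × X => f i q.1 q.2) (Ici 0 ×ˢ univ))
    (hf1 : ∀ i, LipschitzOnBoundedSets (f i)) (hf2 : ∀ i, LinearlyBounded (f i))
    (T : ℝ) (hT : 0 ≤ T) (ξ₀ : X) :
    (∀ u : Control m p T, ∃! x : C(Icc (0 : ℝ) T, X), IsMildSolution hT S f ξ₀ u x) ∧
    ∀ Φ : Control m p T → C(Icc (0 : ℝ) T, X), (∀ u, IsMildSolution hT S f ξ₀ u (Φ u)) →
      IsCompactMap Φ ∧ LocallyLipschitz Φ := by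
  simp only [isMildSolution_iff_picard_eq hp hT hS hf]
  refine ⟨fun u => ?_, fun Φ hΦ => ⟨fun B hB => ?_, fun u₀ => ?_⟩⟩
  · obtain ⟨x, hx⟩ := exists_picard_eq_self hp hT hS hf ξ₀ hf1 hf2 u
    obtain ⟨C, -, hC⟩ := exists_dist_le_of_picard_eq_self (m := m) (p := p) hp hT hS hf ξ₀ hf1 hf2
      ‖u‖
    refine ⟨x, hx, fun y hy => dist_le_zero.1 ?_⟩
    simpa using hC u u le_rfl le_rfl y x hy hx
  · obtain ⟨R, hR⟩ := hB.exists_norm_le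
    exact isCompact_closure_image_of_picard_eq_self hp hT hS hf ξ₀ hf1 hf2 hΦ hR
  · obtain ⟨C, hC0, hC⟩ := exists_dist_le_of_picard_eq_self (m := m) (p := p) hp hT hS hf ξ₀ hf1
      hf2 (‖u₀‖ + 1)
    refine ⟨C.toNNReal, Metric.ball u₀ 1, Metric.ball_mem_nhds _ one_pos,
      LipschitzOnWith.of_dist_le_mul fun u hu v hv => ?_⟩
    have hnorm : ∀ w ∈ Metric.ball u₀ 1, ‖w‖ ≤ ‖u₀‖ + 1 := fun w hw => by
      rw [Metric.mem_ball, dist_eq_norm] at hw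
      linarith [norm_le_norm_add_norm_sub' w u₀]
    rw [Real.coe_toNNReal _ hC0]
    exact hC u v (hnorm u hu) (hnorm v hv) _ _ (hΦ u) (hΦ v)
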